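/- Proposition (D-optimal extended formulation). Let $n,m,k\ge 0$ be integers, let $M_j\in\mathbb{R}^{m\times r_j}$ ($j=1,\dots,n$) be real matrices and let $\varepsilon>0$. Put $\Phi(x)=\log\det\bigl(\varepsilon I+\sum_{j=1}^n M_jM_j^{\top}x_j\bigr)$ for $x\in\{0,1\}^n$. The Bayesian D-optimal design problem is $$(P)\qquad \max\ \Phi(x)\quad\text{s.t.}\quad \sum_{j=1}^n x_j=k,\quad x\in\{0,1\}^n .$$ Put $M_0=\varepsilon^{1/2}I$ and $r_0=m$. The extended formulation is the problem $$(E)\qquad\begin{aligned}\max\ & t\\ \text{s.t. } & t\le\sum_{i=1}^m\log J_{ii},\qquad \sum_{j=0}^n M_jZ_j=J,\qquad J\in\mathbb{R}^{m\times m}\text{ lower triangular},\\ & \|Z_je_i\|^2\le u_{ji}x_j\quad(0\le j\le n,\ 1\le i\le m),\qquad \sum_{j=0}^n u_{ji}\le J_{ii}\quad(1\le i\le m),\\ & \sum_{j=1}^n x_j=k,\qquad x_0=1,\ (x_1,\dots,x_n)\in\{0,1\}^n,\qquad Z_j\in\mathbb{R}^{r_j\times m},\ u_{ji}\ge 0,\end{aligned}$$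 in which $\|\cdot\|$ is the Euclidean norm and the logarithmic constraint is understood to require $J_{ii}>0$ for all $i$. (1) $(E)$ and $(P)$ are equivalent: for all $x\in\mathbb{R}^n$ and $t\in\mathbb{R}$, there are $J,(Z_j),(u_{ji})$ such that $((1,x),t,J,Z,u)$ is feasible for $(E)$ if and only if $x$ is feasible for $(P)$ and $t\le\Phi(x)$. Moreover, $(E)$ and $(P)$ have the same optimal value (in $[-\infty,\infty]$); a vector $x$ is the $x$-part of an optimal solution of $(E)$ if and only if it is an optimal solution of $(P)$; every optimal solution of $(E)$ satisfies $t=\Phi(x)$; and if $k\le n$, the maximum in $(E)$ is attained. (2) The objective of $(E)$ is submodular in $x$: for each $x\in\{0,1\}^n$ the matrix $\varepsilon I+\sum_j M_jM_j^{\top}x_j$ is positive definite, and the maximum $f(x)$ of $t$ over all $(t,J,Z,u)$ that satisfy, together with $(1,x)$, all constraints of $(E)$ other than $\sum_{j=1}^n x_j=k$, exists and equals $\Phi(x)$. The function $f$ satisfies $f(x\vee y)+f(x\wedge y)\le f(x)+f(y)$ for all $x,y\in\{0,1\}^n$, where $\vee$ and $\wedge$ are the componentwise maximum and minimum. -/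

import Mathlib

open scoped Matrix

noncomputable section

namespace BayesDOpt

/-- The Boolean cube `{0,1}^n`, as a set of real vectors. -/
def cube (n : ℕ) : Set (Fin n → ℝ) := {x | ∀ j, x j = 0 ∨ x j = 1}

/-- Submodularity of a function on the Boolean cube
(`⊔` and `⊓` are the componentwise maximum and minimum). -/
def SubmodularOnCube {n : ℕ} (f : (Fin n → ℝ) → ℝ) : Prop :=
  ∀ x ∈ cube n, ∀ y ∈ cube n, f (x ⊔ y) + f (x ⊓ y) ≤ f x + f y

variable {n m : ℕ} {r : Fin n → ℕ}

/-- The regularized information matrix `ε I + ∑ j, M_j M_jᵀ x_j`. -/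
def infoMatrix (ε : ℝ) (M : ∀ j : Fin n, Matrix (Fin m) (Fin (r j)) ℝ) (x : Fin n → ℝ) :
    Matrix (Fin m) (Fin m) ℝ :=
  ε • (1 : Matrix (Fin m) (Fin m) ℝ) + ∑ j, x j • (M j * (M j)ᵀ)

/-- The Bayesian D-optimal criterion `log det (ε I + ∑ j, M_j M_jᵀ x_j)`. -/
def objective (ε : ℝ) (M : ∀ j : Fin n, Matrix (Fin m) (Fin (r j)) ℝ) (x : Fin n → ℝ) : ℝ :=
  Real.log (infoMatrix ε M x).det

/-- The feasible set of the Bayesian D-optimal design problem: binary vectors with sum `k`. -/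
def designs (n k : ℕ) : Set (Fin n → ℝ) := {x | x ∈ cube n ∧ ∑ j, x j = (k : ℝ)}

/-- The numbers of columns `r_j`, `j ∈ [n] ∪ {0}`, where the additional index `0` is `none`
and `r_0 = m`. -/
def extSize (m : ℕ) (r : Fin n → ℕ) : Option (Fin n) → ℕ
  | none => m
  | some j => r j

/-- The matrices `M_j`, `j ∈ [n] ∪ {0}`, where `M_0 = ε^{1/2} I`. -/
def extMatrix (ε : ℝ) (M : ∀ j : Fin n, Matrix (Fin m) (Fin (r j)) ℝ) :
    ∀ j : Option (Fin n), Matrix (Fin m) (Fin (extSize m r j)) ℝ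
  | none => Real.sqrt ε • (1 : Matrix (Fin m) (Fin m) ℝ)
  | some j => M j

/-- The decision variables `(x, t, J, (Z_j), (u_{ji}))` of the extended formulation. -/
structure ExtPoint (m : ℕ) (r : Fin n → ℕ) where
  x : Option (Fin n) → ℝ
  t : ℝ
  J : Matrix (Fin m) (Fin m) ℝ
  Z : ∀ j : Option (Fin n), Matrix (Fin (extSize m r j)) (Fin m) ℝ
  u : Option (Fin n) → Fin m → ℝ

/-- The coordinates `x_1, …, x_n` of a point of the extended formulation. -/
def ExtPoint.design (p : ExtPoint m r) : Fin n → ℝ := fun j => p.x (some j)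

/-- All constraints of the extended formulation except the cardinality constraint. -/
structure ExtConstraints (ε : ℝ) (M : ∀ j : Fin n, Matrix (Fin m) (Fin (r j)) ℝ)
    (p : ExtPoint m r) : Prop where
  /-- The arguments of the logarithms lie in the domain of `log`. -/
  log_dom : ∀ i, 0 < p.J i i
  obj_le : p.t ≤ ∑ i, Real.log (p.J i i)
  factor : ∑ j, extMatrix ε M j * p.Z j = p.J
  lower : p.J.IsLowerTriangular
  /-- The (rotated) second-order cone constraints `‖Z_j e_i‖² ≤ u_{ji} x_j`, Euclidean norm. -/
  soc : ∀ j i, ‖WithLp.toLp 2 (p.Z j *ᵥ Pi.single i (1 : ℝ))‖ ^ 2 ≤ p.u j i * p.x j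
  sum_le : ∀ i, ∑ j, p.u j i ≤ p.J i i
  x_zero : p.x none = 1
  x_bin : p.design ∈ cube n
  u_nonneg : ∀ j i, 0 ≤ p.u j i

/-- The feasible set of the extended formulation. -/
def extFeasible (ε : ℝ) (M : ∀ j : Fin n, Matrix (Fin m) (Fin (r j)) ℝ) (k : ℕ) :
    Set (ExtPoint m r) :=
  {p | ExtConstraints ε M p ∧ ∑ j, p.design j = (k : ℝ)}

/-- The objective values `t` that the extended formulation allows at a given binary `x`. -/
def extValues (ε : ℝ) (M : ∀ j : Fin n, Matrix (Fin m) (Fin (r j)) ℝ) (x : Fin n → ℝ) : Set ℝ :=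
  {t | ∃ p : ExtPoint m r, ExtConstraints ε M p ∧ p.design = x ∧ p.t = t}

/-- The objective of the extended formulation as a function of `x`: the largest `t` over
all choices of the remaining variables. -/
def extObjective (ε : ℝ) (M : ∀ j : Fin n, Matrix (Fin m) (Fin (r j)) ℝ) (x : Fin n → ℝ) : ℝ :=
  sSup (extValues ε M x)

end BayesDOpt

end

/-! For binary `x`, write `A = ∑ x_j M_j M_jᵀ` with `j = 0` included and `x_0 = 1`. Pick a lower
triangular `W` with `W A Wᵀ = 1`, so `det A * ∏ W_ii² = 1`. Triangularity gives `W_ii J_ii = (W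
J)_ii = ∑ x_j ⟨(W M_j)ᵀ e_i, Z_j e_i⟩`; Cauchy–Schwarz and the cone constraints bound its square by
`J_ii`. Hence `W_ii² J_ii ≤ 1`, and the product over `i` gives `∏ J_ii ≤ det A`
(`ExtConstraints.t_le_objective`). The equality case supplies a feasible point
(`exists_extConstraints`). So the formulation projects onto the hypograph of the criterion, which
yields every claim on optima.

Submodularity is then that of `log det`: `det (A + RᴴR) = det A * det (1 + R A⁻¹ Rᴴ)`, and the gain
factor decreases as `A` grows because inversion is antitone. -/

namespace Matrix

open scoped MatrixOrder

/-! ### Determinants under positive semidefinite increments -/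

section Determinant

variable {m : Type*} [Fintype m] [DecidableEq m]

theorem PosSemidef.one_le_det_one_add {S : Matrix m m ℝ} (hS : S.PosSemidef) :
    1 ≤ (1 + S).det := by
  have hs := hS.1.spectral_theorem
  rw [Unitary.conjStarAlgAut_apply] at hs
  set U : Matrix m m ℝ := (hS.1.eigenvectorUnitary : Matrix m m ℝ) with hU
  have hUU : U * star U = 1 := Unitary.coe_mul_star_self _
  have hUU' : star U * U = 1 := Unitary.coe_star_mul_self _
  have h1 : 1 + S = U * diagonal (fun i => 1 + hS.1.eigenvalues i) * star U := by
    have : diagonal (fun i => 1 + hS.1.eigenvalues i)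
        = 1 + diagonal (RCLike.ofReal ∘ hS.1.eigenvalues : m → ℝ) := by
      rw [← diagonal_one, diagonal_add]; rfl
    rw [this, Matrix.mul_add, Matrix.add_mul, Matrix.mul_one, hUU, ← hs]
  rw [h1, det_mul_right_comm, hUU, Matrix.one_mul, det_diagonal]
  exact Finset.one_le_prod fun i _ => le_add_of_nonneg_right (hS.eigenvalues_nonneg i)

theorem PosDef.det_add_eq {A : Matrix m m ℝ} (hA : A.PosDef) (R : Matrix m m ℝ) :
    (A + Rᴴ * R).det = A.det * (1 + R * A⁻¹ * Rᴴ).det :=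
  det_add_mul _ _ hA.det_pos.ne'.isUnit

theorem PosDef.det_le_det_add {A P : Matrix m m ℝ} (hA : A.PosDef) (hP : P.PosSemidef) :
    A.det ≤ (A + P).det := by
  obtain ⟨R, rfl⟩ := CStarAlgebra.nonneg_iff_eq_star_mul_self.1 hP.nonneg
  rw [star_eq_conjTranspose] at hP ⊢
  rw [hA.det_add_eq]
  exact le_mul_of_one_le_right hA.det_pos.le
    (hA.inv.posSemidef.mul_mul_conjTranspose_same R).one_le_det_one_add

/-- The block matrix `[[A + Q, 1], [1, A⁻¹]]` has Schur complements `Q` and `A⁻¹ - (A + Q)⁻¹`, so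
one is positive semidefinite iff the other is. -/
theorem PosDef.posSemidef_inv_sub_inv_add {A Q : Matrix m m ℝ} (hA : A.PosDef)
    (hQ : Q.PosSemidef) : (A⁻¹ - (A + Q)⁻¹).PosSemidef := by
  have hAQ : (A + Q).PosDef := hA.add_posSemidef hQ
  let := hAQ.isUnit.invertible
  let := hA.inv.isUnit.invertible
  have h := (PosDef.fromBlocks₂₂ (A + Q) (1 : Matrix m m ℝ) hA.inv).2 (by
    simpa [nonsing_inv_nonsing_inv _ hA.det_pos.ne'.isUnit] using hQ)
  simpa using (PosDef.fromBlocks₁₁ (1 : Matrix m m ℝ) A⁻¹ hAQ).1 h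

/-- The determinant is log-submodular along positive semidefinite increments. -/
theorem PosDef.det_add_add_mul_det_le {A P Q : Matrix m m ℝ} (hA : A.PosDef)
    (hP : P.PosSemidef) (hQ : Q.PosSemidef) :
    (A + P + Q).det * A.det ≤ (A + P).det * (A + Q).det := by
  obtain ⟨R, rfl⟩ := CStarAlgebra.nonneg_iff_eq_star_mul_self.1 hP.nonneg
  rw [star_eq_conjTranspose] at hP ⊢
  have hAQ : (A + Q).PosDef := hA.add_posSemidef hQ
  have hle : (1 + R * (A + Q)⁻¹ * Rᴴ).det ≤ (1 + R * A⁻¹ * Rᴴ).det := by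
    have h1 : (1 + R * (A + Q)⁻¹ * Rᴴ).PosDef :=
      PosDef.one.add_posSemidef (hAQ.inv.posSemidef.mul_mul_conjTranspose_same R)
    have h2 := h1.det_le_det_add
      ((hA.posSemidef_inv_sub_inv_add hQ).mul_mul_conjTranspose_same R)
    convert h2 using 2
    rw [Matrix.mul_sub, Matrix.sub_mul]
    abel
  rw [add_right_comm, hAQ.det_add_eq, hA.det_add_eq]
  have := mul_le_mul_of_nonneg_left hle (mul_nonneg hAQ.det_pos.le hA.det_pos.le)
  linarith

end Determinant

/-! ### Triangular whitening -/

section Whitening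

variable {m : Type*} [Fintype m] [LinearOrder m]

/-- A positive definite matrix is whitened by a lower triangular matrix. -/
theorem PosDef.exists_isLowerTriangular_mul_mul_transpose_eq_one
    [LocallyFiniteOrderBot m] {A : Matrix m m ℝ}
    (hA : A.PosDef) : ∃ W : Matrix m m ℝ, W.IsLowerTriangular ∧ W * A * Wᵀ = 1 := by
  have hunit : IsUnit (LDL.lowerInv hA) := isUnit_of_invertible _
  have hD : LDL.lowerInv hA * A * (LDL.lowerInv hA)ᴴ = diagonal (LDL.diagEntries hA) :=
    (LDL.diag_eq_lowerInv_conj hA).symm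
  have hpos : ∀ i, 0 < LDL.diagEntries hA i := by
    have h : (diagonal (LDL.diagEntries hA)).PosDef := by
      rw [← hD]
      exact (IsUnit.posDef_star_right_conjugate_iff hunit).2 hA
    exact posDef_diagonal_iff.1 h
  -- The inverse LDL factor only diagonalizes `A`; rescaling its rows normalizes the diagonal to
  -- `1`.
  refine ⟨diagonal (fun i => (√(LDL.diagEntries hA i))⁻¹) * LDL.lowerInv hA, ?_, ?_⟩
  · exact (blockTriangular_diagonal _).mul fun i j hij => LDL.lowerInv_triangular hA hij
  · rw [transpose_mul, diagonal_transpose, ← conjTranspose_eq_transpose_of_trivial]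
    calc _ = diagonal (fun i => (√(LDL.diagEntries hA i))⁻¹) *
          (LDL.lowerInv hA * A * (LDL.lowerInv hA)ᴴ) *
          diagonal (fun i => (√(LDL.diagEntries hA i))⁻¹) := by simp only [Matrix.mul_assoc]
      _ = 1 := by
        rw [hD, diagonal_mul_diagonal, diagonal_mul_diagonal, ← diagonal_one]
        congr 1
        ext i
        have h := Real.mul_self_sqrt (hpos i).le
        have h0 : √(LDL.diagEntries hA i) ≠ 0 := (Real.sqrt_pos.2 (hpos i)).ne'
        field_simp
        nlinarith

theorem IsLowerTriangular.mul_apply_self {B C : Matrix m m ℝ} (hB : B.IsLowerTriangular)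
    (hC : C.IsLowerTriangular) (i : m) : (B * C) i i = B i i * C i i := by
  rw [mul_apply]
  refine Finset.sum_eq_single i (fun k _ hk => ?_) (by simp)
  rcases lt_or_gt_of_ne hk with h | h
  · rw [hC (by simpa using h), mul_zero]
  · rw [hB (by simpa using h), zero_mul]

theorem det_mul_prod_sq_eq_one {A W : Matrix m m ℝ} (hW : W.IsLowerTriangular)
    (h : W * A * Wᵀ = 1) : A.det * ∏ i, W i i ^ 2 = 1 := by
  have h1 := congrArg det h
  rw [det_mul, det_mul, det_transpose, det_one, det_of_isLowerTriangular W hW] at h1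
  rw [Finset.prod_pow]
  linarith

end Whitening

end Matrix

namespace BayesDOpt

open Matrix

variable {n m k : ℕ} {r : Fin n → ℕ} {ε : ℝ}
  {M : ∀ j : Fin n, Matrix (Fin m) (Fin (r j)) ℝ}

/-! ### The information matrix and submodularity of the criterion -/

theorem nonneg_of_mem_cube {x : Fin n → ℝ} (hx : x ∈ cube n) (j : Fin n) : 0 ≤ x j := by
  rcases hx j with h | h <;> simp [h]

theorem finite_cube (n : ℕ) : (cube n).Finite := by
  have h : cube n = Set.univ.pi fun _ : Fin n => ({0, 1} : Set ℝ) := by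
    ext x
    simp [cube]
  rw [h]
  exact Set.Finite.pi fun _ => Set.toFinite _

theorem posSemidef_sum_smul {y : Fin n → ℝ} (hy : ∀ j, 0 ≤ y j) :
    (∑ j, y j • (M j * (M j)ᵀ)).PosSemidef :=
  posSemidef_sum _ fun j _ => (posSemidef_self_mul_conjTranspose (M j)).smul (hy j)

theorem infoMatrix_posDef (hε : 0 < ε) {x : Fin n → ℝ} (hx : ∀ j, 0 ≤ x j) :
    (infoMatrix ε M x).PosDef :=
  (PosDef.one.smul hε).add_posSemidef (posSemidef_sum_smul hx)

theorem infoMatrix_add (x y : Fin n → ℝ) :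
    infoMatrix ε M (x + y) = infoMatrix ε M x + ∑ j, y j • (M j * (M j)ᵀ) := by
  simp only [infoMatrix, Pi.add_apply, add_smul, Finset.sum_add_distrib, add_assoc]

/-- The base point is `x ⊓ y`; the nonnegative increments `x - x ⊓ y` and `y - x ⊓ y` lead to `x`
and `y` separately and to `x ⊔ y` together. -/
theorem submodularOnCube_objective (hε : 0 < ε) : SubmodularOnCube (objective ε M) := by
  intro x hx y hy
  have hz : ∀ j, 0 ≤ (x ⊓ y) j := fun j =>
    le_inf (nonneg_of_mem_cube hx j) (nonneg_of_mem_cube hy j)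
  have hp : ∀ j, 0 ≤ (x - x ⊓ y) j := fun j => sub_nonneg.2 inf_le_left
  have hq : ∀ j, 0 ≤ (y - x ⊓ y) j := fun j => sub_nonneg.2 inf_le_right
  have hxe : x ⊓ y + (x - x ⊓ y) = x := by abel
  have hye : x ⊓ y + (y - x ⊓ y) = y := by abel
  have hs : x ⊓ y + (x - x ⊓ y) + (y - x ⊓ y) = x ⊔ y := by
    rw [hxe, ← add_sub_assoc, ← inf_add_sup x y]
    abel
  have hA : (infoMatrix ε M (x ⊓ y)).PosDef := infoMatrix_posDef hε hz
  have h := hA.det_add_add_mul_det_le (posSemidef_sum_smul (M := M) hp)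
    (posSemidef_sum_smul (M := M) hq)
  rw [← infoMatrix_add, ← infoMatrix_add, ← infoMatrix_add, hs, hxe, hye] at h
  have hpos : ∀ {z : Fin n → ℝ}, (∀ j, 0 ≤ z j) → 0 < (infoMatrix ε M z).det :=
    fun h => (infoMatrix_posDef hε h).det_pos
  have h0 := hpos hz
  have h1 := hpos (nonneg_of_mem_cube hx)
  have h2 := hpos (nonneg_of_mem_cube hy)
  have h3 := hpos (z := x ⊔ y) fun j => le_sup_of_le_left (nonneg_of_mem_cube hx j)
  simp only [objective]
  rw [← Real.log_mul h3.ne' h0.ne', ← Real.log_mul h1.ne' h2.ne']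
  exact Real.log_le_log (mul_pos h3 h0) h

/-! ### The extended formulation at a fixed binary design -/

/-- The vector `(1, x)` of the extended formulation. -/
def extDesign (x : Fin n → ℝ) : Option (Fin n) → ℝ
  | none => 1
  | some j => x j

theorem infoMatrix_eq_sum (hε : 0 ≤ ε) (x : Fin n → ℝ) :
    infoMatrix ε M x = ∑ j, extDesign x j • (extMatrix ε M j * (extMatrix ε M j)ᵀ) := by
  rw [Fintype.sum_option, infoMatrix]
  congr 1
  have h : ε • (1 : Matrix (Fin m) (Fin m) ℝ) =
      (1 : ℝ) • ((√ε • (1 : Matrix (Fin m) (Fin m) ℝ)) *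
        (√ε • (1 : Matrix (Fin m) (Fin m) ℝ))ᵀ) := by
    rw [one_smul, transpose_smul, transpose_one, Matrix.smul_mul, Matrix.mul_smul, smul_smul,
      Real.mul_self_sqrt hε, Matrix.one_mul]
  exact h

theorem norm_sq_mulVec_single {p : ℕ} (Z : Matrix (Fin p) (Fin m) ℝ) (i : Fin m) :
    ‖WithLp.toLp 2 (Z *ᵥ Pi.single i (1 : ℝ))‖ ^ 2 = ∑ l, Z l i ^ 2 := by
  simp [EuclideanSpace.norm_sq_eq]

theorem extDesign_sq {x : Fin n → ℝ} (hx : x ∈ cube n) (j : Option (Fin n)) :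
    extDesign x j ^ 2 = extDesign x j := by
  cases j with
  | none => simp [extDesign]
  | some j => rcases hx j with h | h <;> simp [extDesign, h]

theorem extDesign_eq_zero_or {x : Fin n → ℝ} (hx : x ∈ cube n) (j : Option (Fin n)) :
    extDesign x j = 0 ∨ extDesign x j = 1 := by
  cases j with
  | none => exact .inr rfl
  | some j => exact hx j

/-- This is the `(i, i)` entry of `W A Wᵀ = 1`; it makes the first Cauchy–Schwarz factor equal to
`1`. -/
theorem sum_extDesign_mul_sq (hε : 0 ≤ ε) {x : Fin n → ℝ} {W : Matrix (Fin m) (Fin m) ℝ}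
    (h : W * infoMatrix ε M x * Wᵀ = 1) (i : Fin m) :
    ∑ j, extDesign x j * ∑ l, (W * extMatrix ε M j) i l ^ 2 = 1 := by
  have h1 := congrFun (congrFun h i) i
  rw [infoMatrix_eq_sum hε, Matrix.mul_sum, Matrix.sum_mul, Matrix.sum_apply, one_apply_eq] at h1
  rw [← h1]
  refine Finset.sum_congr rfl fun j _ => ?_
  rw [Matrix.mul_smul, Matrix.smul_mul, Matrix.smul_apply, smul_eq_mul, ← Matrix.mul_assoc,
    Matrix.mul_assoc (W * extMatrix ε M j), ← transpose_mul, mul_apply]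
  simp [sq]

theorem ExtConstraints.x_eq {p : ExtPoint m r} (hp : ExtConstraints ε M p) :
    p.x = extDesign p.design := by
  funext j
  cases j with
  | none => exact hp.x_zero
  | some j => rfl

/-- Cauchy–Schwarz bound for the diagonal of `J` in whitened coordinates. -/
theorem ExtConstraints.sq_mul_diag_le_one (hε : 0 ≤ ε) {p : ExtPoint m r}
    (hp : ExtConstraints ε M p) {W : Matrix (Fin m) (Fin m) ℝ} (hW : W.IsLowerTriangular)
    (h : W * infoMatrix ε M p.design * Wᵀ = 1) (i : Fin m) : W i i ^ 2 * p.J i i ≤ 1 := by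
  set d := extDesign p.design with hd
  have hsoc : ∀ j, ∑ l, p.Z j l i ^ 2 ≤ p.u j i * d j := fun j => by
    rw [← norm_sq_mulVec_single, hd, ← hp.x_eq]
    exact hp.soc j i
  have hd01 : ∀ j, d j = 0 ∨ d j = 1 := extDesign_eq_zero_or hp.x_bin
  -- Where `d j = 0`, the cone constraint forces the column to vanish, so the weight `d j` can be
  -- inserted freely.
  have hZ : ∀ j l, p.Z j l i = d j * p.Z j l i := fun j l => by
    rcases hd01 j with h0 | h1
    · have h2 := hsoc j
      rw [h0, mul_zero] at h2
      have h3 := (Finset.single_le_sum (fun l _ => sq_nonneg (p.Z j l i))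
        (Finset.mem_univ l)).trans h2
      rw [h0, zero_mul]
      exact pow_eq_zero_iff two_ne_zero |>.1 (le_antisymm h3 (sq_nonneg _))
    · rw [h1, one_mul]
  have hdiag : W i i * p.J i i =
      ∑ s : Σ j, Fin (extSize m r j), (d s.1 * (W * extMatrix ε M s.1) i s.2) * p.Z s.1 s.2 i := by
    rw [← hW.mul_apply_self hp.lower, ← hp.factor, Matrix.mul_sum, Matrix.sum_apply,
      Fintype.sum_sigma]
    refine Finset.sum_congr rfl fun j _ => ?_
    rw [← Matrix.mul_assoc, mul_apply]
    refine Finset.sum_congr rfl fun l _ => ?_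
    conv_lhs => rw [hZ j l]
    ring
  have hsum1 : ∑ s : Σ j, Fin (extSize m r j), (d s.1 * (W * extMatrix ε M s.1) i s.2) ^ 2 = 1 := by
    rw [Fintype.sum_sigma, ← sum_extDesign_mul_sq hε h i]
    refine Finset.sum_congr rfl fun j _ => ?_
    rw [Finset.mul_sum]
    refine Finset.sum_congr rfl fun l _ => ?_
    rw [mul_pow, hd, extDesign_sq hp.x_bin]
  have hsum2 : ∑ s : Σ j, Fin (extSize m r j), p.Z s.1 s.2 i ^ 2 ≤ p.J i i := by
    rw [Fintype.sum_sigma]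
    refine (Finset.sum_le_sum fun j _ => (hsoc j).trans ?_).trans (hp.sum_le i)
    rcases hd01 j with h0 | h1
    · simpa [h0] using hp.u_nonneg j i
    · simp [h1]
  have hcs := Finset.sum_mul_sq_le_sq_mul_sq Finset.univ
    (fun s : Σ j, Fin (extSize m r j) => d s.1 * (W * extMatrix ε M s.1) i s.2)
    (fun s => p.Z s.1 s.2 i)
  rw [← hdiag, hsum1, one_mul] at hcs
  have hJ := hp.log_dom i
  have := hcs.trans hsum2
  -- Cauchy–Schwarz gave `(W_ii J_ii)² ≤ J_ii`; cancel one factor `J_ii > 0`.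
  refine le_of_mul_le_mul_right ?_ hJ
  linarith

theorem ExtConstraints.t_le_objective (hε : 0 < ε) {p : ExtPoint m r}
    (hp : ExtConstraints ε M p) : p.t ≤ objective ε M p.design := by
  have hA : (infoMatrix ε M p.design).PosDef := infoMatrix_posDef hε (nonneg_of_mem_cube hp.x_bin)
  obtain ⟨W, hW, h⟩ := hA.exists_isLowerTriangular_mul_mul_transpose_eq_one
  refine hp.obj_le.trans ?_
  rw [← Real.log_prod fun i _ => (hp.log_dom i).ne']
  refine Real.log_le_log (Finset.prod_pos fun i _ => hp.log_dom i) ?_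
  have hdet := det_mul_prod_sq_eq_one hW h
  have hprod : (∏ i, W i i ^ 2) * ∏ i, p.J i i ≤ 1 := by
    rw [← Finset.prod_mul_distrib]
    exact Finset.prod_le_one (fun i _ => mul_nonneg (sq_nonneg _) (hp.log_dom i).le)
      fun i _ => hp.sq_mul_diag_le_one hε.le hW h i
  calc ∏ i, p.J i i = (infoMatrix ε M p.design).det * ((∏ i, W i i ^ 2) * ∏ i, p.J i i) := by
        rw [← mul_assoc, hdet, one_mul]
    _ ≤ _ := mul_le_of_le_one_right hA.det_pos.le hprod

theorem exists_extConstraints (hε : 0 < ε) {x : Fin n → ℝ} (hx : x ∈ cube n) {t : ℝ}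
    (ht : t ≤ objective ε M x) :
    ∃ p : ExtPoint m r, ExtConstraints ε M p ∧ p.design = x ∧ p.t = t := by
  have hA : (infoMatrix ε M x).PosDef := infoMatrix_posDef hε (nonneg_of_mem_cube hx)
  obtain ⟨W, hW, h⟩ := hA.exists_isLowerTriangular_mul_mul_transpose_eq_one
  have hdet := det_mul_prod_sq_eq_one hW h
  have hw : ∀ i, W i i ≠ 0 := fun i hi => by
    rw [Finset.prod_eq_zero (Finset.mem_univ i) (by simp [hi]), mul_zero] at hdet
    exact zero_ne_one hdet
  -- Equality in Cauchy–Schwarz asks for `Z_j e_i` proportional to `x_j (W M_j)ᵀ e_i`. The scale `(W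
  -- i i)⁻¹` gives `W J = D`, hence `W_ii² J_ii = 1`.
  set D : Matrix (Fin m) (Fin m) ℝ := diagonal fun i => (W i i)⁻¹ with hD
  set J := infoMatrix ε M x * Wᵀ * D with hJ
  have hWJ : W * J = D := by
    rw [hJ, ← Matrix.mul_assoc, ← Matrix.mul_assoc, h, Matrix.one_mul]
  have hlow : J.IsLowerTriangular := by
    -- Whitening turns `J` into `W⁻¹ * D`, a product of lower triangular matrices.
    have hWinv : W⁻¹ = infoMatrix ε M x * Wᵀ := inv_eq_right_inv (by rw [← Matrix.mul_assoc, h])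
    let _ : Invertible W := invertibleOfRightInverse W (infoMatrix ε M x * Wᵀ)
      (by rw [← Matrix.mul_assoc, h])
    rw [hJ, ← hWinv]
    exact (blockTriangular_inv_of_blockTriangular hW).mul (blockTriangular_diagonal _)
  have hdiag : ∀ i, J i i = (W i i ^ 2)⁻¹ := fun i => by
    have h1 := hW.mul_apply_self hlow i
    rw [hWJ, hD, diagonal_apply_eq] at h1
    have := hw i
    field_simp at h1 ⊢
    linarith
  set Z : ∀ j : Option (Fin n), Matrix (Fin (extSize m r j)) (Fin m) ℝ :=
    fun j => extDesign x j • ((W * extMatrix ε M j)ᵀ * D) with hZ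
  have hZsq : ∀ j i, ∑ l, Z j l i ^ 2 =
      (W i i ^ 2)⁻¹ * (extDesign x j * ∑ l, (W * extMatrix ε M j) i l ^ 2) := fun j i => by
    rw [Finset.mul_sum, Finset.mul_sum]
    refine Finset.sum_congr rfl fun l _ => ?_
    simp only [hZ, hD]
    rw [Matrix.smul_apply, smul_eq_mul, mul_diagonal, transpose_apply, mul_pow,
      extDesign_sq hx, mul_pow, inv_pow]
    ring
  have hpos : ∀ i, 0 < J i i := fun i => by
    rw [hdiag]
    exact inv_pos.2 (sq_pos_of_ne_zero (hw i))
  refine ⟨⟨extDesign x, t, J, Z, fun j i => ∑ l, Z j l i ^ 2⟩, ?_, rfl, rfl⟩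
  refine ⟨hpos, ?_, ?_, hlow, ?_, ?_, rfl, hx, ?_⟩
  · refine ht.trans_eq ?_
    rw [← Real.log_prod fun i _ => (hpos i).ne', objective]
    simp only [hdiag, Finset.prod_inv_distrib]
    rw [eq_inv_of_mul_eq_one_left hdet]
  · change ∑ j, extMatrix ε M j * Z j = J
    rw [hJ, infoMatrix_eq_sum hε.le, Matrix.sum_mul, Matrix.sum_mul]
    refine Finset.sum_congr rfl fun j _ => ?_
    rw [hZ, Matrix.mul_smul, Matrix.smul_mul, Matrix.smul_mul, transpose_mul]
    simp only [Matrix.mul_assoc]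
  · intro j i
    rw [norm_sq_mulVec_single]
    change ∑ l, Z j l i ^ 2 ≤ (∑ l, Z j l i ^ 2) * extDesign x j
    rw [hZsq]
    refine le_of_eq ?_
    -- The cone constraint is tight because `x_j² = x_j`.
    have := extDesign_sq hx j
    rw [sq] at this
    conv_lhs => rw [← this]
    ring
  · intro i
    change ∑ j, ∑ l, Z j l i ^ 2 ≤ J i i
    simp only [hZsq]
    rw [← Finset.mul_sum, sum_extDesign_mul_sq hε.le h, mul_one, hdiag]
  · intro j i
    change 0 ≤ ∑ l, Z j l i ^ 2
    exact Finset.sum_nonneg fun l _ => sq_nonneg _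

/-! ### Transfer of values and optima -/

theorem exists_extFeasible_iff (hε : 0 < ε) (x : Fin n → ℝ) (t : ℝ) :
    (∃ p ∈ extFeasible ε M k, p.design = x ∧ p.t = t) ↔
      x ∈ designs n k ∧ t ≤ objective ε M x := by
  constructor
  · rintro ⟨p, ⟨hp, hk⟩, rfl, rfl⟩
    exact ⟨⟨hp.x_bin, hk⟩, hp.t_le_objective hε⟩
  · rintro ⟨⟨hx, hk⟩, ht⟩
    obtain ⟨p, hp, rfl, rfl⟩ := exists_extConstraints hε hx ht
    exact ⟨p, ⟨hp, hk⟩, rfl, rfl⟩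

theorem isGreatest_extValues (hε : 0 < ε) {x : Fin n → ℝ} (hx : x ∈ cube n) :
    IsGreatest (extValues ε M x) (objective ε M x) := by
  refine ⟨exists_extConstraints hε hx le_rfl, ?_⟩
  rintro t ⟨p, hp, rfl, rfl⟩
  exact hp.t_le_objective hε

theorem extObjective_eq (hε : 0 < ε) {x : Fin n → ℝ} (hx : x ∈ cube n) :
    extObjective ε M x = objective ε M x :=
  (isGreatest_extValues hε hx).csSup_eq

theorem submodularOnCube_extObjective (hε : 0 < ε) :
    SubmodularOnCube (extObjective ε M) := by
  intro x hx y hy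
  have hsup : x ⊔ y ∈ cube n := fun j => by
    rcases hx j with h | h <;> rcases hy j with h' | h' <;> simp [h, h']
  have hinf : x ⊓ y ∈ cube n := fun j => by
    rcases hx j with h | h <;> rcases hy j with h' | h' <;> simp [h, h']
  rw [extObjective_eq hε hx, extObjective_eq hε hy, extObjective_eq hε hsup,
    extObjective_eq hε hinf]
  exact submodularOnCube_objective hε x hx y hy

/-- Suprema in `EReal` cover infeasible problems too: both sides are then `⊥`. -/
theorem iSup_extFeasible_eq (hε : 0 < ε) :
    (⨆ p ∈ extFeasible ε M k, ((p.t : ℝ) : EReal)) =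
      ⨆ x ∈ designs n k, ((objective ε M x : ℝ) : EReal) := by
  apply le_antisymm
  · refine iSup₂_le fun p hp => ?_
    obtain ⟨hx, ht⟩ := (exists_extFeasible_iff hε _ _).1 ⟨p, hp, rfl, rfl⟩
    exact (EReal.coe_le_coe_iff.2 ht).trans
      (le_iSup₂ (f := fun x (_ : x ∈ designs n k) => ((objective ε M x : ℝ) : EReal)) _ hx)
  · refine iSup₂_le fun x hx => ?_
    obtain ⟨p, hp, -, ht⟩ := (exists_extFeasible_iff (M := M) hε x _).2 ⟨hx, le_rfl⟩
    rw [← ht]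
    exact le_iSup₂ (f := fun (p : ExtPoint m r) (_ : p ∈ extFeasible ε M k) =>
      ((p.t : ℝ) : EReal)) p hp

theorem t_eq_objective_of_isMaxOn (hε : 0 < ε) {p : ExtPoint m r} (hp : p ∈ extFeasible ε M k)
    (hmax : IsMaxOn (fun q => q.t) (extFeasible ε M k) p) : p.t = objective ε M p.design := by
  obtain ⟨hx, ht⟩ := (exists_extFeasible_iff hε _ _).1 ⟨p, hp, rfl, rfl⟩
  obtain ⟨q, hq, -, hqt⟩ := (exists_extFeasible_iff (M := M) hε p.design _).2 ⟨hx, le_rfl⟩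
  exact le_antisymm ht (hqt ▸ hmax hq)

theorem exists_isMaxOn_extFeasible_iff (hε : 0 < ε) (x : Fin n → ℝ) :
    (∃ p ∈ extFeasible ε M k, IsMaxOn (fun q => q.t) (extFeasible ε M k) p ∧ p.design = x) ↔
      (x ∈ designs n k ∧ IsMaxOn (objective ε M) (designs n k) x) := by
  constructor
  · rintro ⟨p, hp, hmax, rfl⟩
    refine ⟨⟨hp.1.x_bin, hp.2⟩, fun y hy => ?_⟩
    obtain ⟨q, hq, -, hqt⟩ := (exists_extFeasible_iff (M := M) hε y _).2 ⟨hy, le_rfl⟩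
    change objective ε M y ≤ objective ε M p.design
    rw [← t_eq_objective_of_isMaxOn hε hp hmax, ← hqt]
    exact hmax hq
  · rintro ⟨hx, hmax⟩
    obtain ⟨p, hp, hpx, hpt⟩ := (exists_extFeasible_iff (M := M) hε x _).2 ⟨hx, le_rfl⟩
    refine ⟨p, hp, fun q hq => ?_, hpx⟩
    change q.t ≤ p.t
    rw [hpt]
    exact (hq.1.t_le_objective hε).trans (hmax ⟨hq.1.x_bin, hq.2⟩)

theorem designs_nonempty (h : k ≤ n) : (designs n k).Nonempty := by
  refine ⟨fun j => if (j : ℕ) < k then 1 else 0, fun j => ?_, ?_⟩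
  · by_cases hj : (j : ℕ) < k <;> simp [hj]
  · rw [Finset.sum_boole, Fin.card_filter_val_lt, min_eq_right h]

theorem exists_isMaxOn_extFeasible (hε : 0 < ε) (h : k ≤ n) :
    ∃ p ∈ extFeasible ε M k, IsMaxOn (fun q => q.t) (extFeasible ε M k) p := by
  obtain ⟨x, hx, hmax⟩ := Set.exists_max_image (designs n k) (objective ε M)
    ((finite_cube n).subset fun _ hx => hx.1) (designs_nonempty h)
  obtain ⟨p, hp, hpmax, -⟩ := (exists_isMaxOn_extFeasible_iff hε x).2 ⟨hx, hmax⟩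
  exact ⟨p, hp, hpmax⟩

end BayesDOpt

theorem mainTheorem12 (n m k : ℕ) (r : Fin n → ℕ)
    (M : ∀ j : Fin n, Matrix (Fin m) (Fin (r j)) ℝ) (ε : ℝ) (hε : 0 < ε) :
    -- the projection of the extended formulation to `(x, t)` is the hypograph of the criterion
    (∀ (x : Fin n → ℝ) (t : ℝ),
      (∃ p ∈ BayesDOpt.extFeasible ε M k, p.design = x ∧ p.t = t) ↔
        x ∈ BayesDOpt.designs n k ∧ t ≤ BayesDOpt.objective ε M x) ∧
    -- the optimal values agree (also when both problems are infeasible)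
    ((⨆ p ∈ BayesDOpt.extFeasible ε M k, ((p.t : ℝ) : EReal)) =
      ⨆ x ∈ BayesDOpt.designs n k, ((BayesDOpt.objective ε M x : ℝ) : EReal)) ∧
    -- the optimal designs agree
    (∀ x : Fin n → ℝ,
      (∃ p ∈ BayesDOpt.extFeasible ε M k,
        IsMaxOn (fun q => q.t) (BayesDOpt.extFeasible ε M k) p ∧ p.design = x) ↔
      (x ∈ BayesDOpt.designs n k ∧
        IsMaxOn (BayesDOpt.objective ε M) (BayesDOpt.designs n k) x)) ∧
    -- at optimal points the objective values agree
    (∀ p ∈ BayesDOpt.extFeasible ε M k,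
      IsMaxOn (fun q => q.t) (BayesDOpt.extFeasible ε M k) p →
        p.t = BayesDOpt.objective ε M p.design) ∧
    -- the optimum is attained whenever a design of size `k` exists
    (k ≤ n → ∃ p ∈ BayesDOpt.extFeasible ε M k,
      IsMaxOn (fun q => q.t) (BayesDOpt.extFeasible ε M k) p) ∧
    -- the objective of the extended formulation is a well-defined function of binary `x`,
    -- equal to the criterion, and it is submodular
    (∀ x ∈ BayesDOpt.cube n,
      (BayesDOpt.infoMatrix ε M x).PosDef ∧
      IsGreatest (BayesDOpt.extValues ε M x) (BayesDOpt.extObjective ε M x) ∧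
      BayesDOpt.extObjective ε M x = BayesDOpt.objective ε M x) ∧
    BayesDOpt.SubmodularOnCube (BayesDOpt.extObjective ε M) := by
  exact ⟨BayesDOpt.exists_extFeasible_iff hε, BayesDOpt.iSup_extFeasible_eq hε,
    BayesDOpt.exists_isMaxOn_extFeasible_iff hε,
    fun _ hp hmax => BayesDOpt.t_eq_objective_of_isMaxOn hε hp hmax,
    BayesDOpt.exists_isMaxOn_extFeasible hε,
    fun x hx => ⟨BayesDOpt.infoMatrix_posDef hε (BayesDOpt.nonneg_of_mem_cube hx),
      BayesDOpt.extObjective_eq (M := M) hε hx ▸ BayesDOpt.isGreatest_extValues hε hx,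
      BayesDOpt.extObjective_eq hε hx⟩,
    BayesDOpt.submodularOnCube_extObjective hε⟩
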